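/- Let $X$ be a hyperbolic space, that is, a geodesic metric space that is Gromov $\delta$-hyperbolic for some $\delta\ge 0$ (not assumed proper), and let $G$ be any group acting on $X$ by isometries. Let $\partial X$ be the Gromov boundary of $X$ (classes of sequences converging at infinity), and let the limit set $\partial_G X\subseteq\partial X$ be the set of limits in $\partial X$ of sequences contained in an orbit of $G$. Suppose that the action is of type $(3)^+$: $\partial_G X$ consists of exactly two points, and each of them is fixed by $G$. Let $\zeta$ be one of these two points. A quasi-morphism is a function $f:G\to\mathbb R$ with $\sup_{g,h}|f(gh)-f(g)-f(h)|<\infty$; it is homogeneous if $f(g^n)=nf(g)$ for all $g\in G$, $n\in\mathbb Z$. The Busemann quasi-morphism $B$ at $\zeta$ is the homogeneous quasi-morphism within bounded distance of $$g\mapsto \liminf_{n\to\infty}\big(d(x_n,x_0)-d(x_n,gx_0)\big),$$ where $(x_n)_{n\ge 0}$ is a sequence in $X$ tending to $\zeta$; it exists, is unique, and does not depend on the sequence. A quasi-isometric embedding is a map $q$ with $\frac1K d(x,y)-\epsilon\le d(q(x),q(y))\le K d(x,y)+\epsilon$ for some $K\ge1$, $\epsilon\ge 0$; it is a quasi-isometry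 if moreover every point of the target is within some uniform distance $C$ of its image. A quasi-action of $G$ on a metric space $Y$ is a map $\alpha:G\times Y\to Y$ such that, for some fixed $K\ge 1$ and $\epsilon,C\ge0$, every $\alpha(g,\cdot)$ is a $(K,\epsilon,C)$ quasi-isometry, $d(\alpha(1,y),y)\le C$ and $d(\alpha(g,\alpha(h,y)),\alpha(gh,y))\le C$ for all $g,h\in G$, $y\in Y$. It is cobounded if some $\{\alpha(g,y_0):g\in G\}$ has every point of $Y$ within a uniform distance. A quasi-action $\alpha$ on $Y$ reduces to a quasi-action $\beta$ on $Z$ if there is a quasi-isometric embedding $F:Z\to Y$ with $\sup_{g,z}d\big(F(\beta(g,z)),\alpha(g,F(z))\big)<\infty$; such a reduction $F$ is an equivalence if $F$ is a quasi-isometry. Then $\beta(g,t)=t+B(g)$ is a quasi-action of $G$ on $\mathbb R$ (translation by $B$), and the action of $G$ on $X$ reduces to $\beta$ by a map $F:\mathbb R\to X$ which is an equivalence if the action is cobounded. Moreover the action is cobounded if and only if $X$ is a quasi-line, that is, a geodesic metric space quasi-isometric to $\mathbb R$. -/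

import Mathlib

open Filter Topology

namespace CoarseHyp

section Coarse

variable {X Y : Type*} [MetricSpace X] [MetricSpace Y]

/-- Any two points are joined by an isometrically embedded interval. -/
def IsGeodesicSpace (X : Type*) [MetricSpace X] : Prop :=
  ∀ x y : X, ∃ γ : ℝ → X, γ 0 = x ∧ γ (dist x y) = y ∧
    ∀ s ∈ Set.Icc 0 (dist x y), ∀ t ∈ Set.Icc 0 (dist x y), dist (γ s) (γ t) = |s - t|

/-- `S` is `C`-coarse dense. -/
def IsCoarseDenseWith (C : ℝ) (S : Set X) : Prop :=
  ∀ x : X, ∃ s ∈ S, dist x s ≤ C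

/-- A `(K, ε)` quasi-isometric embedding. -/
structure IsQIEmbeddingWith (K ε : ℝ) (q : X → Y) : Prop where
  one_le : 1 ≤ K
  eps_nonneg : 0 ≤ ε
  lower : ∀ x y : X, (1 / K) * dist x y - ε ≤ dist (q x) (q y)
  upper : ∀ x y : X, dist (q x) (q y) ≤ K * dist x y + ε

/-- A `(K, ε, C)` quasi-isometry. -/
structure IsQuasiIsometryWith (K ε C : ℝ) (q : X → Y) : Prop where
  embedding : IsQIEmbeddingWith K ε q
  nonneg : 0 ≤ C
  coarse_onto : IsCoarseDenseWith C (Set.range q)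

def IsQIEmbedding (q : X → Y) : Prop := ∃ K ε : ℝ, IsQIEmbeddingWith K ε q

def IsQuasiIsometry (q : X → Y) : Prop := ∃ K ε C : ℝ, IsQuasiIsometryWith K ε C q

/-- A quasi-line: a geodesic metric space which is quasi-isometric to `ℝ`. -/
def IsQuasiLine (X : Type*) [MetricSpace X] : Prop :=
  IsGeodesicSpace X ∧ ∃ q : X → ℝ, IsQuasiIsometry q

end Coarse

section QuasiAction

variable {G X Y : Type*} [Group G] [MetricSpace X] [MetricSpace Y]

/-- A `(K, ε, C)` quasi-action of `G` on `X`. -/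
structure IsQuasiActionWith (K ε C : ℝ) (α : G → X → X) : Prop where
  quasiIsometry : ∀ g : G, IsQuasiIsometryWith K ε C (α g)
  one : ∀ x : X, dist (α 1 x) x ≤ C
  mul : ∀ (x : X) (g h : G), dist (α g (α h x)) (α (g * h) x) ≤ C

def IsQuasiAction (α : G → X → X) : Prop :=
  ∃ K ε C : ℝ, 1 ≤ K ∧ 0 ≤ ε ∧ 0 ≤ C ∧ IsQuasiActionWith K ε C α

/-- Some quasi-orbit is coarse dense. -/
def IsCobounded (α : G → X → X) : Prop :=
  ∃ x₀ : X, ∃ C : ℝ, IsCoarseDenseWith C (Set.range fun g : G => α g x₀)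

def IsCoarseEquivariant (α : G → X → X) (β : G → Y → Y) (F : X → Y) : Prop :=
  ∃ M : ℝ, 0 ≤ M ∧ ∀ (x : X) (g : G), dist (F (α g x)) (β g (F x)) ≤ M

/-- `F : Y → X` exhibits a reduction of the quasi-action `α` on `X` to the quasi-action `β` on
`Y`: it is a coarse `G`-equivariant quasi-isometric embedding from `β` to `α`. -/
structure IsReduction (α : G → X → X) (β : G → Y → Y) (F : Y → X) : Prop where
  source : IsQuasiAction α
  target : IsQuasiAction β
  embedding : IsQIEmbedding F
  equivariant : IsCoarseEquivariant β α F

/-- The map `F : Y → X` is an equivalence between the quasi-actions `α` on `X` and `β` on `Y`: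
it is a coarse `G`-equivariant quasi-isometry. -/
structure IsEquivalence (α : G → X → X) (β : G → Y → Y) (F : Y → X) : Prop where
  source : IsQuasiAction α
  target : IsQuasiAction β
  quasiIsometry : IsQuasiIsometry F
  equivariant : IsCoarseEquivariant β α F

/-- The (quasi-)action underlying an action of `G`. -/
def actionMap (G X : Type*) [Group G] [MulAction G X] : G → X → X := fun g x => g • x

/-- `G` translating by `f` on `ℝ`. -/
def translation (f : G → ℝ) : G → ℝ → ℝ := fun g x => x + f g

end QuasiAction

section Quasimorphism

variable {G : Type*} [Group G]

def IsQuasimorphism (f : G → ℝ) : Prop :=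
  ∃ D : ℝ, 0 ≤ D ∧ ∀ g h : G, |f (g * h) - f g - f h| ≤ D

/-- `B` is a homogenisation of `f`: a homogeneous quasi-morphism within bounded distance
of `f`. -/
structure IsHomogenisation (f B : G → ℝ) : Prop where
  quasimorphism : IsQuasimorphism B
  homogeneous : ∀ (g : G) (n : ℤ), B (g ^ n) = n * B g
  close : ∃ C : ℝ, ∀ g : G, |f g - B g| ≤ C

end Quasimorphism

section Hyperbolic

/-- The Gromov product of `x` and `y` based at `w`. -/
noncomputable def gromovProduct {X : Type*} [MetricSpace X] (w x y : X) : ℝ :=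
  (dist w x + dist w y - dist x y) / 2

/-- A geodesic metric space that is `δ`-hyperbolic for some `δ`. -/
class IsHyperbolicSpace (X : Type*) [MetricSpace X] : Prop where
  geodesic : IsGeodesicSpace X
  hyperbolic : ∃ δ : ℝ, 0 ≤ δ ∧ ∀ w x y z : X,
    min (gromovProduct w x y) (gromovProduct w y z) - δ ≤ gromovProduct w x z

variable {X : Type*} [MetricSpace X]

/-- `(xᵢ | yⱼ) → ∞` as `i, j → ∞`. -/
def SeqRel (x y : ℕ → X) : Prop :=
  ∀ w : X, Tendsto (fun p : ℕ × ℕ => gromovProduct w (x p.1) (y p.2)) atTop atTop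

theorem gromovProduct_comm (w x y : X) : gromovProduct w x y = gromovProduct w y x := by
  unfold gromovProduct
  rw [dist_comm x y]
  ring

theorem SeqRel.symm {x y : ℕ → X} (h : SeqRel x y) : SeqRel y x := by
  intro w
  rw [tendsto_atTop]
  intro M
  obtain ⟨N, hN⟩ := eventually_atTop.1 ((tendsto_atTop.1 (h w)) M)
  refine eventually_atTop.2 ⟨N.swap, fun p hp => ?_⟩
  rw [gromovProduct_comm]
  exact hN p.swap ⟨hp.2, hp.1⟩

theorem SeqRel.trans [IsHyperbolicSpace X] {x y z : ℕ → X} (h : SeqRel x y) (h' : SeqRel y z) :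
    SeqRel x z := by
  intro w
  obtain ⟨δ, -, hδ⟩ := IsHyperbolicSpace.hyperbolic (X := X)
  rw [tendsto_atTop]
  intro M
  obtain ⟨N, hN⟩ := eventually_atTop.1 ((tendsto_atTop.1 (h w)) (M + δ))
  obtain ⟨N', hN'⟩ := eventually_atTop.1 ((tendsto_atTop.1 (h' w)) (M + δ))
  refine eventually_atTop.2 ⟨(N.1, N'.2), fun p hp => ?_⟩
  have h1 := hN (p.1, max N.2 N'.1) ⟨hp.1, le_max_left _ _⟩
  have h2 := hN' (max N.2 N'.1, p.2) ⟨le_max_right _ _, hp.2⟩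
  have h3 := hδ w (x p.1) (y (max N.2 N'.1)) (z p.2)
  have h4 := le_min h1 h2
  linarith

/-- Sequences in `X` converging at infinity. -/
def GromovSeq (X : Type*) [MetricSpace X] : Type _ := {x : ℕ → X // SeqRel x x}

instance gromovSetoid (X : Type*) [MetricSpace X] [IsHyperbolicSpace X] :
    Setoid (GromovSeq X) where
  r x y := SeqRel x.1 y.1
  iseqv := ⟨fun x => x.2, fun h => h.symm, fun h h' => h.trans h'⟩

/-- The Gromov boundary `∂X`. -/
def Boundary (X : Type*) [MetricSpace X] [IsHyperbolicSpace X] : Type _ :=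
  Quotient (gromovSetoid X)

/-- The sequence `x` in `X` tends to the boundary point `ζ` (in `X ∪ ∂X`). -/
def TendsToBoundary [IsHyperbolicSpace X] (x : ℕ → X) (ζ : Boundary X) : Prop :=
  ∃ h : SeqRel x x, (Quotient.mk (gromovSetoid X) ⟨x, h⟩ : Boundary X) = ζ

/-- The quasi-horofunction of a sequence. -/
noncomputable def quasiHorofunction (x : ℕ → X) (z : X) : ℝ :=
  liminf (fun n : ℕ => dist (x n) (x 0) - dist (x n) z) atTop

variable {G : Type*} [Group G] [MulAction G X] [IsIsometricSMul G X]

theorem SeqRel.smul {x y : ℕ → X} (h : SeqRel x y) (g : G) :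
    SeqRel (fun n => g • x n) (fun n => g • y n) := by
  intro w
  have key : ∀ a b : X, gromovProduct w (g • a) (g • b) = gromovProduct (g⁻¹ • w) a b := by
    intro a b
    unfold gromovProduct
    have e : ∀ c : X, dist w (g • c) = dist (g⁻¹ • w) c := by
      intro c
      rw [← dist_smul g (g⁻¹ • w) c, smul_inv_smul]
    rw [e, e, dist_smul]
  simpa only [key] using h (g⁻¹ • w)

/-- The action of `G` on `∂X` induced by an isometric action on `X`. -/
instance boundaryAction [IsHyperbolicSpace X] : MulAction G (Boundary X) where
  smul g ζ := Quotient.map (sa := gromovSetoid X) (sb := gromovSetoid X)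
    (fun x : GromovSeq X => (⟨fun n => g • x.1 n, x.2.smul g⟩ : GromovSeq X))
    (fun _ _ h => SeqRel.smul h g) ζ
  one_smul ζ := by
    induction ζ using Quotient.inductionOn with
    | h x => exact congrArg (Quotient.mk _) (Subtype.ext (funext fun n => one_smul G (x.1 n)))
  mul_smul g h ζ := by
    induction ζ using Quotient.inductionOn with
    | h x => exact congrArg (Quotient.mk _) (Subtype.ext (funext fun n => mul_smul g h (x.1 n)))

/-- The limit set `∂_G X`: the boundary points which are accumulation points of some
(equivalently any) orbit, that is, limits of sequences in that orbit. -/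
def limitSet (G X : Type*) [Group G] [MetricSpace X] [IsHyperbolicSpace X] [MulAction G X] :
    Set (Boundary X) :=
  {ζ | ∃ (x₀ : X) (u : ℕ → G), TendsToBoundary (fun n => u n • x₀) ζ}

/-- An isometric action of type `(3)⁺`: lineal (the limit set has exactly two points), with both
limit points fixed by `G`. -/
def IsTypeThreePlus (G X : Type*) [Group G] [MetricSpace X] [IsHyperbolicSpace X] [MulAction G X]
    [IsIsometricSMul G X] : Prop :=
  ∃ p q : Boundary X, p ≠ q ∧ limitSet G X = {p, q} ∧ ∀ g : G, g • p = p ∧ g • q = q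

/-- `B` is the Busemann quasi-morphism of the action at `ζ`: the homogenisation of
`g ↦ η_x (g x₀)`, where `η_x` is the quasi-horofunction of a sequence `x = (x₀, x₁, …)` tending
to `ζ`. -/
def IsBusemannQuasimorphism [IsHyperbolicSpace X] (ζ : Boundary X) (B : G → ℝ) : Prop :=
  ∃ x : ℕ → X, TendsToBoundary x ζ ∧
    IsHomogenisation (fun g : G => quasiHorofunction x (g • x 0)) B

end Hyperbolic

end CoarseHyp

namespace CoarseHyp

section Homogenisation

variable {G : Type*} [Group G]

theorem IsQuasimorphism.exists_zpow_bound {f : G → ℝ} (hf : IsQuasimorphism f) (k : ℤ) :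
    ∃ C : ℝ, ∀ h : G, |f (h ^ k) - k * f h| ≤ C := by
  obtain ⟨D, -, hD⟩ := hf
  induction k using Int.induction_on with
  | zero => exact ⟨|f 1|, fun h => by simp⟩
  | succ i ih =>
    obtain ⟨C, hC⟩ := ih
    refine ⟨C + D, fun h => ?_⟩
    have h1 := hC h
    have h2 := hD (h ^ (i : ℤ)) h
    rw [← zpow_add_one] at h2
    rw [abs_le] at *
    push_cast at *
    constructor <;> linarith [h1.1, h1.2, h2.1, h2.2]
  | pred i ih =>
    obtain ⟨C, hC⟩ := ih
    refine ⟨C + D, fun h => ?_⟩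
    have h1 := hC h
    have h2 := hD (h ^ (-(i : ℤ) - 1)) h
    rw [← zpow_add_one, sub_add_cancel] at h2
    rw [abs_le] at *
    push_cast at *
    constructor <;> linarith [h1.1, h1.2, h2.1, h2.2]

theorem IsQuasimorphism.of_close {f B : G → ℝ} (hf : IsQuasimorphism f) {C : ℝ}
    (hC : ∀ g, |f g - B g| ≤ C) : IsQuasimorphism B := by
  obtain ⟨D, hD0, hD⟩ := hf
  have hC0 : 0 ≤ C := (abs_nonneg _).trans (hC 1)
  refine ⟨D + 3 * C, by positivity, fun g h => ?_⟩
  have h1 := hC g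
  have h2 := hC h
  have h3 := hC (g * h)
  have h4 := hD g h
  rw [abs_le] at *
  constructor <;> linarith [h1.1, h1.2, h2.1, h2.2, h3.1, h3.2, h4.1, h4.2]

theorem IsQuasimorphism.exists_isHomogenisation {f : G → ℝ} (hf : IsQuasimorphism f) :
    ∃ B : G → ℝ, IsHomogenisation f B := by
  obtain ⟨D, hD0, hD⟩ := id hf
  have hstep : ∀ (g : G) (n : ℕ),
      dist (f (g ^ 2 ^ n) / 2 ^ n) (f (g ^ 2 ^ (n + 1)) / 2 ^ (n + 1)) ≤ D / 2 / 2 ^ n := by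
    intro g n
    have h := hD (g ^ 2 ^ n) (g ^ 2 ^ n)
    rw [← pow_add, ← two_mul, ← pow_succ'] at h
    have e : f (g ^ 2 ^ n) / 2 ^ n - f (g ^ 2 ^ (n + 1)) / 2 ^ (n + 1)
        = -(f (g ^ 2 ^ (n + 1)) - f (g ^ 2 ^ n) - f (g ^ 2 ^ n)) / (2 * 2 ^ n) := by
      rw [pow_succ (2 : ℝ)]
      field_simp
      ring
    rw [Real.dist_eq, e, abs_div, abs_neg, abs_of_pos (by positivity : (0 : ℝ) < 2 * 2 ^ n),
      div_div]
    gcongr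
  choose B hB using fun g => cauchySeq_tendsto_of_complete (cauchySeq_of_le_geometric_two (hstep g))
  have hclose : ∀ g, |f g - B g| ≤ D := fun g => by
    have h := dist_le_of_le_geometric_two_of_tendsto₀ (hstep g) (hB g)
    simpa [Real.dist_eq] using h
  refine ⟨B, hf.of_close hclose, fun g k => ?_, D, hclose⟩
  obtain ⟨C, hC⟩ := hf.exists_zpow_bound k
  have hlim : Tendsto (fun n : ℕ => f ((g ^ k) ^ 2 ^ n) / 2 ^ n - k * (f (g ^ 2 ^ n) / 2 ^ n)) atTop
      (𝓝 (B (g ^ k) - k * B g)) := (hB (g ^ k)).sub ((hB g).const_mul _)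
  have hzero : Tendsto (fun n : ℕ => f ((g ^ k) ^ 2 ^ n) / 2 ^ n - k * (f (g ^ 2 ^ n) / 2 ^ n)) atTop
      (𝓝 0) := by
    refine squeeze_zero_norm (a := fun n : ℕ => C / 2 ^ n) (fun n => ?_)
      (tendsto_const_nhds.div_atTop (tendsto_pow_atTop_atTop_of_one_lt (by norm_num)))
    have h := hC (g ^ 2 ^ n)
    have e : (g ^ k) ^ 2 ^ n = (g ^ 2 ^ n) ^ k := by
      rw [← zpow_natCast, ← zpow_natCast, ← zpow_mul, ← zpow_mul, mul_comm]
    rw [e, mul_div_assoc', ← sub_div, Real.norm_eq_abs, abs_div,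
      abs_of_pos (by positivity : (0 : ℝ) < 2 ^ n)]
    gcongr
  exact sub_eq_zero.1 (tendsto_nhds_unique hlim hzero)

theorem eq_of_homogeneous_of_close {B B' : G → ℝ} (hB : ∀ (g : G) (n : ℤ), B (g ^ n) = n * B g)
    (hB' : ∀ (g : G) (n : ℤ), B' (g ^ n) = n * B' g) {C : ℝ} (hC : ∀ g, |B g - B' g| ≤ C) :
    B = B' := by
  funext g
  by_contra hne
  have hpos : 0 < |B g - B' g| := abs_pos.2 (sub_ne_zero.2 hne)
  obtain ⟨n, hn⟩ := exists_nat_gt (C / |B g - B' g|)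
  rw [div_lt_iff₀ hpos] at hn
  have h := hC (g ^ (n : ℤ))
  rw [hB, hB', ← mul_sub, abs_mul] at h
  simp only [Int.cast_natCast, Nat.abs_cast] at h
  linarith

end Homogenisation

section FourPoint

variable {X : Type*} [MetricSpace X]

theorem gromovProduct_self (w x : X) : gromovProduct w x x = dist w x := by
  simp [gromovProduct]

theorem gromovProduct_le_add_dist (w z x y : X) :
    gromovProduct w x y ≤ gromovProduct z x y + dist z w := by
  unfold gromovProduct
  have h1 := dist_triangle w z x
  have h2 := dist_triangle w z y
  rw [dist_comm w z] at h1 h2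
  linarith

theorem gromovProduct_smul_smul {G : Type*} [Group G] [MulAction G X] [IsIsometricSMul G X]
    (g : G) (w x y : X) : gromovProduct (g • w) (g • x) (g • y) = gromovProduct w x y := by
  simp [gromovProduct]

/-- The four-point inequality with constant `δ`. -/
def FourPoint (X : Type*) [MetricSpace X] (δ : ℝ) : Prop :=
  ∀ w x y z : X,
    min (gromovProduct w x y) (gromovProduct w y z) - δ ≤ gromovProduct w x z

variable {δ : ℝ}

theorem FourPoint.dist_add_dist_le (hδ : FourPoint X δ) (x y z w : X) :
    dist x z + dist y w ≤ max (dist x w + dist y z) (dist x y + dist z w) + 2 * δ := by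
  have h := hδ w x y z
  unfold gromovProduct at h
  rw [dist_comm w x, dist_comm w y, dist_comm w z] at h
  rcases min_choice ((dist x w + dist y w - dist x y) / 2)
    ((dist y w + dist z w - dist y z) / 2) with h' | h' <;> rw [h'] at h
  · linarith [le_max_right (dist x w + dist y z) (dist x y + dist z w)]
  · linarith [le_max_left (dist x w + dist y z) (dist x y + dist z w)]

theorem FourPoint.sub_le_sub (hδ : FourPoint X δ) {x y z w : X}
    (h : dist z w + δ < gromovProduct w x y) :
    dist x z - dist x w ≤ dist y z - dist y w + 2 * δ := by
  have h1 := hδ.dist_add_dist_le x y z w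
  have h2 := dist_triangle_right x w z
  rw [dist_comm w z] at h2
  unfold gromovProduct at h
  rw [dist_comm w x, dist_comm w y] at h
  rcases max_choice (dist x w + dist y z) (dist x y + dist z w) with h' | h' <;> rw [h'] at h1 <;>
    linarith

theorem FourPoint.abs_sub_sub_le (hδ : FourPoint X δ) {x y z w : X}
    (h : dist z w + δ < gromovProduct w x y) :
    |(dist x z - dist x w) - (dist y z - dist y w)| ≤ 2 * δ := by
  have h1 := hδ.sub_le_sub h
  rw [gromovProduct_comm] at h
  have h2 := hδ.sub_le_sub h
  rw [abs_le]
  constructor <;> linarith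

/-- Coarsely, points between `x` and `y` are determined by their distance to `x`. -/
theorem FourPoint.dist_le_abs_sub_add (hδ : FourPoint X δ) {x y z w : X} {C : ℝ}
    (hz : gromovProduct z x y ≤ C) (hw : gromovProduct w x y ≤ C) :
    dist z w ≤ |dist x z - dist x w| + 2 * C + 2 * δ := by
  have h := hδ.dist_add_dist_le z x w y
  unfold gromovProduct at hz hw
  rw [dist_comm z x, dist_comm z y] at hz
  rw [dist_comm w x, dist_comm w y] at hw
  rw [dist_comm z x, dist_comm z y, dist_comm w y] at h
  rcases max_choice (dist y z + dist x w) (dist x z + dist y w) with h' | h' <;> rw [h'] at h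
  · linarith [neg_abs_le (dist x z - dist x w)]
  · linarith [le_abs_self (dist x z - dist x w)]

theorem FourPoint.gromovProduct_le (hδ : FourPoint X δ) {w x x' y y' : X} {C : ℝ}
    (h : gromovProduct w x y ≤ C) (hx : C + 2 * δ < gromovProduct w x x')
    (hy : C + 2 * δ < gromovProduct w y y') (h0 : 0 ≤ δ) :
    gromovProduct w x' y' ≤ C + 2 * δ := by
  by_contra! hc
  have h1 := hδ w x x' y'
  have h2 := hδ w x y' y
  rw [gromovProduct_comm w y' y] at h2
  have h3 := lt_min hx hc
  have h4 : C + δ < min (gromovProduct w x y') (gromovProduct w y y') :=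
    lt_min (by linarith) (by linarith)
  linarith

end FourPoint

section Sequences

variable {X : Type*} [MetricSpace X] {δ : ℝ}

theorem SeqRel.exists_lt {x y : ℕ → X} (h : SeqRel x y) (w : X) (M : ℝ) :
    ∃ N : ℕ, ∀ n ≥ N, ∀ m ≥ N, M < gromovProduct w (x n) (y m) := by
  obtain ⟨N, hN⟩ := eventually_atTop.1 ((h w).eventually_gt_atTop M)
  exact ⟨max N.1 N.2, fun n hn m hm =>
    hN (n, m) ⟨(le_max_left _ _).trans hn, (le_max_right _ _).trans hm⟩⟩

theorem FourPoint.exists_abs_sub_le (hδ : FourPoint X δ) {x y : ℕ → X} (h : SeqRel x y)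
    (z w : X) : ∃ N : ℕ, ∀ n ≥ N, ∀ m ≥ N,
      |(dist (x n) z - dist (x n) w) - (dist (y m) z - dist (y m) w)| ≤ 2 * δ := by
  obtain ⟨N, hN⟩ := h.exists_lt w (dist z w + δ)
  exact ⟨N, fun n hn m hm => hδ.abs_sub_sub_le (hN n hn m hm)⟩

theorem FourPoint.abs_quasiHorofunction_sub_le (hδ : FourPoint X δ) {x : ℕ → X}
    (h : SeqRel x x) (z : X) : ∃ N : ℕ, ∀ n ≥ N,
      |quasiHorofunction x z - (dist (x n) (x 0) - dist (x n) z)| ≤ 2 * δ := by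
  obtain ⟨N, hN⟩ := hδ.exists_abs_sub_le h (x 0) z
  refine ⟨N, fun n hn => ?_⟩
  have hb : ∀ m ≥ N, dist (x m) (x 0) - dist (x m) z
      ∈ Set.Icc (dist (x n) (x 0) - dist (x n) z - 2 * δ)
        (dist (x n) (x 0) - dist (x n) z + 2 * δ) := fun m hm => by
    have := abs_le.1 (hN n hn m hm)
    constructor <;> linarith [this.1, this.2]
  have hlo : ∀ᶠ m in atTop, dist (x n) (x 0) - dist (x n) z - 2 * δ
      ≤ dist (x m) (x 0) - dist (x m) z := eventually_atTop.2 ⟨N, fun m hm => (hb m hm).1⟩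
  have hhi : ∀ᶠ m in atTop, dist (x m) (x 0) - dist (x m) z
      ≤ dist (x n) (x 0) - dist (x n) z + 2 * δ := eventually_atTop.2 ⟨N, fun m hm => (hb m hm).2⟩
  have h1 := le_liminf_of_le (IsCoboundedUnder.of_frequently_le hhi.frequently) hlo
  have h2 := liminf_le_of_frequently_le hhi.frequently (isBoundedUnder_of_eventually_ge hlo)
  unfold quasiHorofunction
  rw [abs_le]
  constructor <;> linarith

/-- Non-equivalent sequences have bounded Gromov products. -/
theorem FourPoint.exists_gromovProduct_le (hδ : FourPoint X δ) (h0 : 0 ≤ δ) {x y : ℕ → X}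
    (hx : SeqRel x x) (hy : SeqRel y y) (h : ¬ SeqRel x y) :
    ∃ (o : X) (C : ℝ) (N : ℕ), ∀ n ≥ N, ∀ m ≥ N, gromovProduct o (x n) (y m) ≤ C := by
  simp only [SeqRel, tendsto_atTop, not_forall] at h
  obtain ⟨o, M, h⟩ := h
  have h := not_eventually.1 h
  obtain ⟨N₁, hN₁⟩ := hx.exists_lt o (M + 2 * δ)
  obtain ⟨N₂, hN₂⟩ := hy.exists_lt o (M + 2 * δ)
  obtain ⟨p, hp, hM⟩ := frequently_atTop.1 h (max N₁ N₂, max N₁ N₂)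
  have hp1 : max N₁ N₂ ≤ p.1 := hp.1
  have hp2 : max N₁ N₂ ≤ p.2 := hp.2
  refine ⟨o, M + 2 * δ, max N₁ N₂, fun n hn m hm => ?_⟩
  simp only [max_le_iff] at hp1 hp2
  exact hδ.gromovProduct_le (not_le.1 hM).le (hN₁ _ hp1.1 _ ((le_max_left _ _).trans hn))
    (hN₂ _ hp2.2 _ ((le_max_right _ _).trans hm)) h0

/-- `z` is a point coarsely between the limits of `x` and `y`, at horofunction height `t`. -/
def IsAxisPoint (x y : ℕ → X) (o : X) (C t : ℝ) (z : X) : Prop :=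
  ∃ N : ℕ, ∀ n ≥ N, ∀ m ≥ N, gromovProduct z (x n) (y m) ≤ C ∧
    |dist (x n) o - dist (x n) z - t| ≤ C

theorem IsAxisPoint.mono {x y : ℕ → X} {o z : X} {C C' t : ℝ} (h : IsAxisPoint x y o C t z)
    (hC : C ≤ C') : IsAxisPoint x y o C' t z := by
  obtain ⟨N, hN⟩ := h
  exact ⟨N, fun n hn m hm => ⟨(hN n hn m hm).1.trans hC, (hN n hn m hm).2.trans hC⟩⟩

theorem IsAxisPoint.abs_sub_le {x y : ℕ → X} {o z w : X} {C s t : ℝ}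
    (hz : IsAxisPoint x y o C t z) (hw : IsAxisPoint x y o C s w) :
    |t - s| ≤ dist z w + 2 * C := by
  obtain ⟨N₁, h₁⟩ := hz
  obtain ⟨N₂, h₂⟩ := hw
  have h1 := (h₁ _ (le_max_left N₁ N₂) _ (le_max_left N₁ N₂)).2
  have h2 := (h₂ _ (le_max_right N₁ N₂) _ (le_max_right N₁ N₂)).2
  have h3 := abs_dist_sub_le z w (x (max N₁ N₂))
  rw [dist_comm z (x _), dist_comm w (x _)] at h3
  rw [abs_le] at *
  constructor <;> linarith [h1.1, h1.2, h2.1, h2.2, h3.1, h3.2]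

theorem IsAxisPoint.dist_le (hδ : FourPoint X δ) {x y : ℕ → X} {o z w : X} {C s t : ℝ}
    (hz : IsAxisPoint x y o C t z) (hw : IsAxisPoint x y o C s w) :
    dist z w ≤ |t - s| + 4 * C + 2 * δ := by
  obtain ⟨N₁, h₁⟩ := hz
  obtain ⟨N₂, h₂⟩ := hw
  obtain ⟨h1, h1'⟩ := h₁ _ (le_max_left N₁ N₂) _ (le_max_left N₁ N₂)
  obtain ⟨h2, h2'⟩ := h₂ _ (le_max_right N₁ N₂) _ (le_max_right N₁ N₂)
  have h3 := hδ.dist_le_abs_sub_add h1 h2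
  have h4 : |dist (x (max N₁ N₂)) z - dist (x (max N₁ N₂)) w| ≤ |t - s| + 2 * C := by
    have h5 := le_abs_self (t - s)
    have h6 := neg_abs_le (t - s)
    rw [abs_le] at h1' h2' ⊢
    constructor <;> linarith [h1'.1, h1'.2, h2'.1, h2'.2]
  linarith

theorem FourPoint.exists_isAxisPoint (hδ : FourPoint X δ) (h0 : 0 ≤ δ) (hX : IsGeodesicSpace X)
    {x y : ℕ → X} (hx : SeqRel x x) (hy : SeqRel y y) {o : X} {C : ℝ} {N : ℕ}
    (hC : ∀ n ≥ N, ∀ m ≥ N, gromovProduct o (x n) (y m) ≤ C) (hC0 : 0 ≤ C) (t : ℝ) :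
    ∃ z, IsAxisPoint x y o (2 * δ) t z := by
  obtain ⟨N₁, h₁⟩ := hx.exists_lt o (|t| + 2 * C + 2 * δ + 2 * δ)
  obtain ⟨N₂, h₂⟩ := hy.exists_lt o (|t| + 2 * C + 2 * δ + 2 * δ)
  obtain ⟨n, hn, hn₁, hn₂⟩ : ∃ n, N ≤ n ∧ N₁ ≤ n ∧ N₂ ≤ n :=
    ⟨max N (max N₁ N₂), by simp, by simp, by simp⟩
  have hxn := h₁ n hn₁ n hn₁
  have hyn := h₂ n hn₂ n hn₂
  rw [gromovProduct_self, dist_comm] at hxn hyn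
  have ho := hC n hn n hn
  obtain ⟨γ, γ0, γ1, hγ⟩ := hX (x n) (y n)
  have ht1 := le_abs_self t
  have ht2 := neg_abs_le t
  have hmem : dist (x n) o - t ∈ Set.Icc 0 (dist (x n) (y n)) := by
    unfold gromovProduct at ho
    rw [dist_comm o, dist_comm o] at ho
    constructor <;> linarith
  set z := γ (dist (x n) o - t) with hz
  have hxz : dist (x n) z = dist (x n) o - t := by
    rw [← γ0, hz, hγ 0 ⟨le_rfl, dist_nonneg⟩ _ hmem, γ0, zero_sub, abs_neg, abs_of_nonneg hmem.1]
  have hzy : dist z (y n) = dist (x n) (y n) - (dist (x n) o - t) := by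
    conv_lhs => rw [← γ1]
    rw [hz, hγ _ hmem _ ⟨dist_nonneg, le_rfl⟩, abs_sub_comm, abs_of_nonneg (by linarith [hmem.2])]
  have hprod : gromovProduct z (x n) (y n) = 0 := by
    unfold gromovProduct
    rw [hzy, dist_comm z, hxz]
    ring
  have hzo : dist z o ≤ |t| + 2 * C + 2 * δ := by
    have h := hδ.dist_le_abs_sub_add (hprod.le.trans hC0) ho
    rwa [hxz, sub_sub_cancel_left, abs_neg] at h
  refine ⟨z, n, fun k hk m hm => ⟨?_, ?_⟩⟩
  · have h1 := h₁ n hn₁ k (hn₁.trans hk)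
    have h2 := h₂ n hn₂ m (hn₂.trans hm)
    have h3 := gromovProduct_le_add_dist o z (x n) (x k)
    have h4 := gromovProduct_le_add_dist o z (y n) (y m)
    have h5 := hδ.gromovProduct_le hprod.le (x' := x k) (y' := y m) (by linarith) (by linarith) h0
    linarith
  · have h1 := hδ.abs_sub_sub_le (x := x n) (y := x k) (z := z) (w := o)
      (by linarith [h₁ n hn₁ k (hn₁.trans hk)])
    rw [hxz] at h1
    rw [abs_le] at h1 ⊢
    constructor <;> linarith [h1.1, h1.2]

end Sequences

section Action

variable {X : Type*} [MetricSpace X] {δ : ℝ} {G : Type*} [Group G] [MulAction G X]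
  [IsIsometricSMul G X]

theorem dist_smul_eq_dist_inv_smul (g : G) (a b : X) : dist a (g • b) = dist (g⁻¹ • a) b := by
  rw [← dist_smul g (g⁻¹ • a) b, smul_inv_smul]

theorem FourPoint.isQuasimorphism_quasiHorofunction (hδ : FourPoint X δ) (h0 : 0 ≤ δ)
    {x : ℕ → X} (hx : SeqRel x x) (hfix : ∀ g : G, SeqRel (fun n => g • x n) x) :
    IsQuasimorphism (fun g : G => quasiHorofunction x (g • x 0)) := by
  refine ⟨8 * δ, by positivity, fun g h => ?_⟩
  obtain ⟨N₁, h₁⟩ := hδ.abs_quasiHorofunction_sub_le hx ((g * h) • x 0)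
  obtain ⟨N₂, h₂⟩ := hδ.abs_quasiHorofunction_sub_le hx (g • x 0)
  obtain ⟨N₃, h₃⟩ := hδ.abs_quasiHorofunction_sub_le hx (h • x 0)
  obtain ⟨N₄, h₄⟩ := hδ.exists_abs_sub_le (hfix g⁻¹) (x 0) (h • x 0)
  obtain ⟨n, k₁, k₂, k₃, k₄⟩ : ∃ n, N₁ ≤ n ∧ N₂ ≤ n ∧ N₃ ≤ n ∧ N₄ ≤ n :=
    ⟨max (max N₁ N₂) (max N₃ N₄), by simp, by simp, by simp, by simp⟩
  have h1 := h₁ n k₁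
  have h2 := h₂ n k₂
  have h3 := h₃ n k₃
  have h4 := h₄ n k₄ n k₄
  simp only [← dist_smul_eq_dist_inv_smul, ← mul_smul] at h4
  rw [abs_le] at *
  constructor <;> linarith [h1.1, h1.2, h2.1, h2.2, h3.1, h3.2, h4.1, h4.2]

theorem FourPoint.abs_quasiHorofunction_sub_quasiHorofunction_le (hδ : FourPoint X δ)
    {x y : ℕ → X} (hx : SeqRel x x) (hy : SeqRel y y) (hxy : SeqRel x y) (g : G) :
    |quasiHorofunction x (g • x 0) - quasiHorofunction y (g • y 0)|
      ≤ 2 * dist (x 0) (y 0) + 6 * δ := by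
  obtain ⟨N₁, h₁⟩ := hδ.abs_quasiHorofunction_sub_le hx (g • x 0)
  obtain ⟨N₂, h₂⟩ := hδ.abs_quasiHorofunction_sub_le hy (g • y 0)
  obtain ⟨N₃, h₃⟩ := hδ.exists_abs_sub_le hxy (x 0) (g • x 0)
  obtain ⟨n, k₁, k₂, k₃⟩ : ∃ n, N₁ ≤ n ∧ N₂ ≤ n ∧ N₃ ≤ n :=
    ⟨max (max N₁ N₂) N₃, by simp, by simp, by simp⟩
  have h1 := h₁ n k₁
  have h2 := h₂ n k₂
  have h3 := h₃ n k₃ n k₃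
  have h4 := abs_dist_sub_le (x 0) (y 0) (y n)
  have h5 := abs_dist_sub_le (g • x 0) (g • y 0) (y n)
  rw [dist_smul] at h5
  rw [dist_comm _ (y n), dist_comm _ (y n)] at h4 h5
  rw [abs_le] at *
  constructor <;>
    linarith [h1.1, h1.2, h2.1, h2.2, h3.1, h3.2, h4.1, h4.2, h5.1, h5.2]

/-- The coarse axis is coarsely invariant, and the action moves heights by the Busemann
quasi-morphism. -/
theorem IsAxisPoint.smul (hδ : FourPoint X δ) (h0 : 0 ≤ δ) {x y : ℕ → X} (hx : SeqRel x x)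
    (hfx : ∀ g : G, SeqRel (fun n => g • x n) x) (hfy : ∀ g : G, SeqRel (fun n => g • y n) y)
    {B : G → ℝ} {A : ℝ} (hB : ∀ g : G, |quasiHorofunction x (g • x 0) - B g| ≤ A)
    {o z : X} {C t : ℝ} (hz : IsAxisPoint x y o C t z) (g : G) :
    IsAxisPoint x y o (C + 4 * δ + 2 * dist (x 0) o + A) (t + B g) (g • z) := by
  have hA : 0 ≤ A := (abs_nonneg _).trans (hB 1)
  obtain ⟨N, hN⟩ := hz
  obtain ⟨N₁, h₁⟩ := (hfx g⁻¹).symm.exists_lt z (C + 2 * δ)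
  obtain ⟨N₂, h₂⟩ := (hfy g⁻¹).symm.exists_lt z (C + 2 * δ)
  obtain ⟨N₃, h₃⟩ := hδ.abs_quasiHorofunction_sub_le hx (g • x 0)
  obtain ⟨N₄, h₄⟩ := hδ.exists_abs_sub_le (hfx g⁻¹) o z
  obtain ⟨K, k₀, k₁, k₂, k₃, k₄⟩ : ∃ n, N ≤ n ∧ N₁ ≤ n ∧ N₂ ≤ n ∧ N₃ ≤ n ∧ N₄ ≤ n :=
    ⟨max N (max (max N₁ N₂) (max N₃ N₄)), by simp, by simp, by simp, by simp, by simp⟩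
  have hd : 0 ≤ dist (x 0) o := dist_nonneg
  refine ⟨K, fun n hn m hm => ⟨?_, ?_⟩⟩
  · have h := hδ.gromovProduct_le (hN K k₀ K k₀).1 (h₁ K k₁ n (k₁.trans hn))
      (h₂ K k₂ m (k₂.trans hm)) h0
    rw [← gromovProduct_smul_smul g, smul_inv_smul, smul_inv_smul] at h
    linarith
  · have h1 := (hN n (k₀.trans hn) n (k₀.trans hn)).2
    have h2 := h₃ n (k₃.trans hn)
    have h3 := h₄ n (k₄.trans hn) n (k₄.trans hn)
    have h4 := hB g
    have h5 := abs_dist_sub_le (x 0) o (x n)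
    have h6 := abs_dist_sub_le (g • x 0) (g • o) (x n)
    rw [dist_smul] at h6
    rw [dist_comm _ (x n), dist_comm _ (x n)] at h5 h6
    simp only [← dist_smul_eq_dist_inv_smul] at h3
    rw [abs_le] at *
    constructor <;>
      linarith [h1.1, h1.2, h2.1, h2.2, h3.1, h3.2, h4.1, h4.2, h5.1, h5.2, h6.1, h6.2]

end Action

section QuasiIsometry

variable {X Y : Type*} [MetricSpace X] [MetricSpace Y]

theorem IsQIEmbeddingWith.dist_le {K ε : ℝ} {q : X → Y} (hq : IsQIEmbeddingWith K ε q) (x y : X) :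
    dist x y ≤ K * (dist (q x) (q y) + ε) := by
  have h := hq.lower x y
  have hK : 0 < K := one_pos.trans_le hq.one_le
  rw [one_div, sub_le_iff_le_add] at h
  exact (inv_mul_le_iff₀ hK).1 h

theorem isQuasiIsometryWith_of_isometry {q : X → X} (h : ∀ x y, dist (q x) (q y) = dist x y)
    (hs : Function.Surjective q) {C : ℝ} (hC : 0 ≤ C) : IsQuasiIsometryWith 1 0 C q where
  embedding :=
    { one_le := le_rfl
      eps_nonneg := le_rfl
      lower := fun x y => by rw [h]; simp
      upper := fun x y => by rw [h]; simp }
  nonneg := hC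
  coarse_onto := fun x => ⟨x, hs x, by simpa using hC⟩

theorem IsQIEmbeddingWith.comp {Z : Type*} [MetricSpace Z] {K ε K' ε' : ℝ} {q : Y → Z} {r : X → Y}
    (hq : IsQIEmbeddingWith K ε q) (hr : IsQIEmbeddingWith K' ε' r) :
    IsQIEmbeddingWith (K * K') (K * ε' + ε) (q ∘ r) where
  one_le := one_le_mul_of_one_le_of_one_le hq.one_le hr.one_le
  eps_nonneg := add_nonneg (mul_nonneg (zero_le_one.trans hq.one_le) hr.eps_nonneg) hq.eps_nonneg
  lower x y := by
    have hK : 1 ≤ K := hq.one_le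
    have h1 := hq.lower (r x) (r y)
    have h2 := mul_le_mul_of_nonneg_left (hr.lower x y) (by positivity : 0 ≤ 1 / K)
    have h3 : 1 / K * ε' ≤ K * ε' := by
      refine mul_le_mul_of_nonneg_right ?_ hr.eps_nonneg
      exact ((div_le_one (by positivity)).2 hK).trans hK
    have h4 : 1 / (K * K') * dist x y = 1 / K * (1 / K' * dist x y) := by
      rw [one_div, one_div, one_div, mul_inv, mul_assoc]
    simp only [Function.comp_apply]
    linarith
  upper x y := by
    have h1 := hq.upper (r x) (r y)
    have h2 := mul_le_mul_of_nonneg_left (hr.upper x y) (zero_le_one.trans hq.one_le)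
    simp only [Function.comp_apply]
    linarith

/-- Quasi-isometries have quasi-inverses. -/
theorem IsQuasiIsometry.exists_inverse {q : X → Y} (hq : IsQuasiIsometry q) :
    ∃ r : Y → X, IsQuasiIsometry r := by
  obtain ⟨K, ε, C, hq⟩ := hq
  have h0 := hq.coarse_onto
  simp only [IsCoarseDenseWith, Set.exists_range_iff] at h0
  choose r hr using h0
  have hK : 1 ≤ K := hq.embedding.one_le
  have hε := hq.embedding.eps_nonneg
  have hC := hq.nonneg
  have htri : ∀ a b, |dist a b - dist (q (r a)) (q (r b))| ≤ 2 * C := fun a b => by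
    have h1 := dist_dist_dist_le a b (q (r a)) (q (r b))
    rw [Real.dist_eq] at h1
    linarith [hr a, hr b]
  refine ⟨r, K, K * (2 * C + ε), K * (C + ε), ⟨hK, by positivity, fun a b => ?_, fun a b => ?_⟩,
    by positivity, fun x => ⟨r (q x), ⟨q x, rfl⟩, ?_⟩⟩
  · have h1 := (abs_le.1 (htri a b)).2
    have h2 := hq.embedding.upper (r a) (r b)
    have hd : dist a b ≤ K * dist (r a) (r b) + (2 * C + ε) := by linarith
    have h3 := mul_le_mul_of_nonneg_left hd (by positivity : 0 ≤ 1 / K)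
    have h4 : 1 / K * (K * dist (r a) (r b) + (2 * C + ε))
        = dist (r a) (r b) + 1 / K * (2 * C + ε) := by field_simp
    have h5 : 1 / K * (2 * C + ε) ≤ K * (2 * C + ε) :=
      mul_le_mul_of_nonneg_right (((div_le_one (by positivity)).2 hK).trans hK) (by positivity)
    linarith
  · have h1 := (abs_le.1 (htri a b)).1
    have h2 := hq.embedding.dist_le (r a) (r b)
    have h3 : K * (dist (q (r a)) (q (r b)) + ε) ≤ K * (dist a b + 2 * C + ε) := by
      gcongr; linarith
    linarith
  · refine (hq.embedding.dist_le _ _).trans ?_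
    gcongr
    exact hr _

theorem exists_abs_sub_le_of_step {h : ℕ → ℝ} {S c : ℝ} (hS : ∀ n, |h (n + 1) - h n| ≤ S)
    (h0 : h 0 ≤ c) {N : ℕ} (hN : c ≤ h N) : ∃ n, |h n - c| ≤ S := by
  classical
  have hex : ∃ n, c ≤ h n := ⟨N, hN⟩
  rcases hn : Nat.find hex with _ | k
  · have h1 := Nat.find_spec hex
    rw [hn] at h1
    exact ⟨0, by rw [le_antisymm h0 h1, sub_self, abs_zero]; exact (abs_nonneg _).trans (hS 0)⟩
  · have h1 := Nat.find_spec hex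
    have h2 := not_le.1 (Nat.find_min hex (m := k) (by omega))
    rw [hn] at h1
    refine ⟨k + 1, ?_⟩
    rw [abs_of_nonneg (sub_nonneg.2 h1)]
    linarith [(abs_le.1 (hS k)).2]

theorem IsQIEmbeddingWith.neg {K ε : ℝ} {h : X → ℝ} (hh : IsQIEmbeddingWith K ε h) :
    IsQIEmbeddingWith K ε (fun x => -h x) :=
  ⟨hh.one_le, hh.eps_nonneg, fun x y => by simpa using hh.lower x y,
    fun x y => by simpa using hh.upper x y⟩

theorem IsQIEmbeddingWith.exists_le {K ε : ℝ} {h : ℝ → ℝ} (hh : IsQIEmbeddingWith K ε h) (c : ℝ) :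
    ∃ n : ℤ, h n ≤ c := by
  by_contra! hc
  have hK : 1 ≤ K := hh.one_le
  have hε := hh.eps_nonneg
  have hstep : ∀ n : ℕ, |h ((n + 1 : ℕ) : ℝ) - h (n : ℝ)| ≤ K + ε := fun n => by
    have h1 := hh.upper ((n + 1 : ℕ) : ℝ) n
    simpa [Real.dist_eq] using h1
  have hbig : ∀ M : ℝ, ∀ k : ℤ, K * (|h 0| + |c| + |M| + ε) ≤ |(k : ℝ)| → M ≤ h k := by
    intro M k hk
    have h1 := hk.trans (by simpa [Real.dist_eq] using hh.dist_le (k : ℝ) 0)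
    have h2 := le_of_mul_le_mul_left h1 (by positivity)
    have h3 := hc k
    have h4 := neg_abs_le (h 0)
    have h5 := neg_abs_le c
    have h6 := le_abs_self M
    have h7 := le_abs_self c
    have h8 := le_abs_self (h 0)
    have h9 := abs_nonneg M
    rcases abs_cases (h k - h 0) with ⟨h', -⟩ | ⟨h', -⟩ <;> rw [h'] at h2 <;> linarith
  obtain ⟨m, hm⟩ := exists_nat_gt (max (K * (|h 0| + |c| + |h 0| + ε)) (K * (K + ε + ε)))
  obtain ⟨hm1, hm2⟩ := max_lt_iff.1 hm
  have hmle : h 0 ≤ h (-m : ℝ) := by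
    have := hbig (h 0) (-m) (by simpa using hm1.le)
    simpa using this
  obtain ⟨N, hN⟩ := exists_nat_ge (K * (|h 0| + |c| + |h (-m : ℝ)| + ε))
  have hNle : h (-m : ℝ) ≤ h (N : ℝ) := by
    have := hbig (h (-m : ℝ)) N (by simpa using hN)
    simpa using this
  obtain ⟨n, hn⟩ := exists_abs_sub_le_of_step (h := fun n : ℕ => h n) hstep (by simpa using hmle)
    hNle
  have h1 := hh.dist_le (n : ℝ) (-m : ℝ)
  rw [Real.dist_eq, Real.dist_eq, sub_neg_eq_add, abs_of_nonneg (by positivity)] at h1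
  have h2 : K * (|h n - h (-m : ℝ)| + ε) ≤ K * (K + ε + ε) := by gcongr
  have h3 : (0 : ℝ) ≤ n := n.cast_nonneg
  linarith

/-- Quasi-isometric embeddings of the line into itself are coarsely onto. -/
theorem IsQIEmbeddingWith.isCoarseDenseWith_range {K ε : ℝ} {h : ℝ → ℝ}
    (hh : IsQIEmbeddingWith K ε h) : IsCoarseDenseWith (K + ε) (Set.range h) := by
  have key : ∀ {h : ℝ → ℝ}, IsQIEmbeddingWith K ε h → ∀ (c : ℝ) (a b : ℤ), a ≤ b → h a ≤ c →
      c ≤ h b → ∃ t, |h t - c| ≤ K + ε := by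
    intro h hh c a b hab ha hb
    obtain ⟨N, rfl⟩ := Int.le.dest hab
    obtain ⟨n, hn⟩ := exists_abs_sub_le_of_step (h := fun n : ℕ => h (a + n)) (S := K + ε)
      (c := c) (N := N) (fun n => by
        have h1 := hh.upper (a + (n + 1 : ℕ) : ℝ) (a + n)
        simpa [Real.dist_eq] using h1) (by simpa using ha) (by simpa using hb)
    exact ⟨_, hn⟩
  intro c
  obtain ⟨a, ha⟩ := hh.exists_le c
  obtain ⟨b, hb⟩ := hh.neg.exists_le (-c)
  rw [neg_le_neg_iff] at hb
  obtain ⟨t, ht⟩ : ∃ t, |h t - c| ≤ K + ε := by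
    rcases le_total a b with hab | hab
    · exact key hh c a b hab ha hb
    · obtain ⟨t, ht⟩ := key hh.neg (-c) b a hab (neg_le_neg hb) (neg_le_neg ha)
      exact ⟨t, by rwa [neg_sub_neg, abs_sub_comm] at ht⟩
  exact ⟨h t, ⟨t, rfl⟩, by rwa [dist_comm, Real.dist_eq]⟩

end QuasiIsometry

section QuasiAction

variable {G X : Type*} [Group G] [MetricSpace X] [MulAction G X]

theorem isQuasiAction_actionMap [IsIsometricSMul G X] : IsQuasiAction (actionMap G X) :=
  ⟨1, 0, 0, le_rfl, le_rfl, le_rfl,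
    fun g => isQuasiIsometryWith_of_isometry (dist_smul g) (MulAction.surjective g) le_rfl,
    fun x => by simp [actionMap], fun x g h => by simp [actionMap, mul_smul]⟩

theorem isQuasiAction_translation {B : G → ℝ} (hB : IsQuasimorphism B) :
    IsQuasiAction (translation B) := by
  obtain ⟨D, hD0, hD⟩ := hB
  refine ⟨1, 0, D, le_rfl, le_rfl, hD0,
    fun g => isQuasiIsometryWith_of_isometry (fun x y => ?_) (fun y => ⟨y - B g, ?_⟩) hD0,
    fun x => ?_, fun x g h => ?_⟩
  · simp [translation]
  · simp [translation]
  · have h := hD 1 1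
    rw [Real.dist_eq]
    simpa [translation] using h
  · have h := hD g h
    rw [Real.dist_eq, abs_sub_comm]
    convert h using 2
    simp only [translation]
    ring

variable {B : G → ℝ} {F : ℝ → X}

/-- A reduction of a cobounded action to a translation action is an equivalence. -/
theorem IsReduction.isEquivalence [IsIsometricSMul G X]
    (hF : IsReduction (actionMap G X) (translation B) F) (hc : IsCobounded (actionMap G X)) :
    IsEquivalence (actionMap G X) (translation B) F := by
  refine ⟨hF.source, hF.target, ?_, hF.equivariant⟩
  obtain ⟨K, ε, hq⟩ := hF.embedding
  obtain ⟨M, hM, he⟩ := hF.equivariant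
  obtain ⟨x₀, C, hC⟩ := hc
  have hC0 : 0 ≤ C := by
    obtain ⟨s, -, hs⟩ := hC x₀
    exact dist_nonneg.trans hs
  refine ⟨K, ε, C + dist x₀ (F 0) + M, hq, by positivity, fun x => ?_⟩
  obtain ⟨_, ⟨g, rfl⟩, hg⟩ := hC x
  refine ⟨_, ⟨translation B g 0, rfl⟩, ?_⟩
  have h1 := he 0 g
  have h2 := dist_triangle4 x (g • x₀) (g • F 0) (F (translation B g 0))
  rw [dist_smul] at h2
  rw [dist_comm] at h1
  simp only [actionMap] at h1 hg
  linarith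

/-- An action on a quasi-line reducing to translation by a non-zero homogeneous map is
cobounded. -/
theorem IsReduction.isCobounded (hF : IsReduction (actionMap G X) (translation B) F)
    (hB : ∀ (g : G) (n : ℤ), B (g ^ n) = n * B g) {g : G} (hg : B g ≠ 0) (hX : IsQuasiLine X) :
    IsCobounded (actionMap G X) := by
  obtain ⟨K, ε, hq⟩ := hF.embedding
  obtain ⟨M, hM, he⟩ := hF.equivariant
  obtain ⟨-, r, K', ε', C', hr⟩ := hX
  have hd := (hr.embedding.comp hq).isCoarseDenseWith_range
  refine ⟨F 0, K' * (K' * K + (K' * ε + ε') + ε') + (K * |B g| + ε) + M, fun x => ?_⟩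
  obtain ⟨_, ⟨t, rfl⟩, ht⟩ := hd (r x)
  have hK : 1 ≤ K := hq.one_le
  have hK' : 1 ≤ K' := hr.embedding.one_le
  have h1 : dist x (F t) ≤ K' * (K' * K + (K' * ε + ε') + ε') := by
    refine (hr.embedding.dist_le _ _).trans ?_
    gcongr
    exact ht
  have h2 : dist (F t) (F (translation B (g ^ ⌊t / B g⌋) 0)) ≤ K * |B g| + ε := by
    refine (hq.upper _ _).trans ?_
    gcongr
    have e : t - (0 + (⌊t / B g⌋ : ℝ) * B g) = Int.fract (t / B g) * B g := by
      rw [Int.fract, sub_mul, div_mul_cancel₀ _ hg, zero_add]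
    rw [translation, hB, Real.dist_eq, e, abs_mul, abs_of_nonneg (Int.fract_nonneg _)]
    exact mul_le_of_le_one_left (abs_nonneg _) (Int.fract_lt_one _).le
  have h3 := he 0 (g ^ ⌊t / B g⌋)
  refine ⟨_, ⟨g ^ ⌊t / B g⌋, rfl⟩, ?_⟩
  have h4 := dist_triangle4 x (F t) (F (translation B (g ^ ⌊t / B g⌋) 0))
    (actionMap G X (g ^ ⌊t / B g⌋) (F 0))
  linarith

theorem IsReduction.exists_ne_zero [IsHyperbolicSpace X] [IsIsometricSMul G X]
    (hF : IsReduction (actionMap G X) (translation B) F) {ζ : Boundary X}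
    (hζ : ζ ∈ limitSet G X) : ∃ g, B g ≠ 0 := by
  by_contra! h
  obtain ⟨M, hM, he⟩ := hF.equivariant
  obtain ⟨x₀, u, hu, -⟩ := hζ
  obtain ⟨N, hN⟩ := hu.exists_lt (F 0) (M + dist x₀ (F 0))
  have h1 := hN N le_rfl N le_rfl
  rw [gromovProduct_self] at h1
  have h2 := he 0 (u N)
  simp only [translation, h, add_zero, actionMap] at h2
  have h3 := dist_triangle (F 0) (u N • F 0) (u N • x₀)
  rw [dist_smul, dist_comm (F 0) x₀] at h3
  linarith

end QuasiAction

section Boundary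

variable {G X : Type*} [Group G] [MetricSpace X] [IsHyperbolicSpace X] [MulAction G X]
  [IsIsometricSMul G X]

theorem TendsToBoundary.seqRel {x y : ℕ → X} {ζ : Boundary X} (hx : TendsToBoundary x ζ)
    (hy : TendsToBoundary y ζ) : SeqRel x y := by
  obtain ⟨hx, rfl⟩ := hx
  obtain ⟨hy, e⟩ := hy
  exact SeqRel.symm (Quotient.exact (s := gromovSetoid X) e)

theorem TendsToBoundary.eq_of_seqRel {x y : ℕ → X} {ζ ξ : Boundary X} (hx : TendsToBoundary x ζ)
    (hy : TendsToBoundary y ξ) (h : SeqRel x y) : ζ = ξ := by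
  obtain ⟨hx, rfl⟩ := hx
  obtain ⟨hy, rfl⟩ := hy
  exact Quotient.sound (s := gromovSetoid X) h

theorem exists_tendsToBoundary (ζ : Boundary X) : ∃ x : ℕ → X, TendsToBoundary x ζ := by
  obtain ⟨x, rfl⟩ := Quotient.exists_rep (s := gromovSetoid X) ζ
  exact ⟨x.1, x.2, rfl⟩

theorem TendsToBoundary.smul {x : ℕ → X} {ζ : Boundary X} (hx : TendsToBoundary x ζ) (g : G) :
    TendsToBoundary (fun n => g • x n) (g • ζ) := by
  obtain ⟨hx, rfl⟩ := hx
  exact ⟨hx.smul g, rfl⟩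

theorem TendsToBoundary.seqRel_smul {x : ℕ → X} {ζ : Boundary X} (hx : TendsToBoundary x ζ)
    (hζ : ∀ g : G, g • ζ = ζ) (g : G) : SeqRel (fun n => g • x n) x := by
  have h := hx.smul g
  rw [hζ] at h
  exact h.seqRel hx

/-- The Busemann quasi-morphism at a fixed boundary point exists and is unique. -/
theorem existsUnique_isBusemannQuasimorphism {ζ : Boundary X} (hζ : ∀ g : G, g • ζ = ζ) :
    ∃! B : G → ℝ, IsBusemannQuasimorphism ζ B := by
  obtain ⟨δ, h0, hδ⟩ := IsHyperbolicSpace.hyperbolic (X := X)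
  obtain ⟨x, hx⟩ := exists_tendsToBoundary ζ
  obtain ⟨B, hB⟩ := (FourPoint.isQuasimorphism_quasiHorofunction hδ h0 (hx.seqRel hx)
    (hx.seqRel_smul hζ)).exists_isHomogenisation
  refine ⟨B, ⟨x, hx, hB⟩, ?_⟩
  rintro B' ⟨y, hy, hB'⟩
  obtain ⟨C, hC⟩ := hB.close
  obtain ⟨C', hC'⟩ := hB'.close
  refine eq_of_homogeneous_of_close hB'.homogeneous hB.homogeneous
    (C := C' + (2 * dist (y 0) (x 0) + 6 * δ) + C) fun g => ?_
  have h1 := hC g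
  have h2 := hC' g
  have h3 := FourPoint.abs_quasiHorofunction_sub_quasiHorofunction_le hδ (hy.seqRel hy)
    (hx.seqRel hx) (hy.seqRel hx) g
  rw [abs_le] at *
  constructor <;> linarith [h1.1, h1.2, h2.1, h2.2, h3.1, h3.2]

/-- If two distinct boundary points are fixed, then the action reduces to translation by the
Busemann quasi-morphism at either of them. -/
theorem IsBusemannQuasimorphism.exists_isReduction {ζ ξ : Boundary X} (hne : ζ ≠ ξ)
    (hζ : ∀ g : G, g • ζ = ζ) (hξ : ∀ g : G, g • ξ = ξ) {B : G → ℝ}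
    (hB : IsBusemannQuasimorphism ζ B) :
    ∃ F : ℝ → X, IsReduction (actionMap G X) (translation B) F := by
  obtain ⟨δ, h0, hδ⟩ := IsHyperbolicSpace.hyperbolic (X := X)
  obtain ⟨x, hx, hB⟩ := hB
  obtain ⟨y, hy⟩ := exists_tendsToBoundary ξ
  obtain ⟨A, hA⟩ := hB.close
  have hA0 : 0 ≤ A := (abs_nonneg _).trans (hA 1)
  obtain ⟨o, C, N, hC⟩ := FourPoint.exists_gromovProduct_le hδ h0 (hx.seqRel hx) (hy.seqRel hy)
    fun h => hne (hx.eq_of_seqRel hy h)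
  choose F hF using FourPoint.exists_isAxisPoint hδ h0 IsHyperbolicSpace.geodesic (hx.seqRel hx)
    (hy.seqRel hy) (fun n hn m hm => (hC n hn m hm).trans (le_max_left C 0)) (le_max_right C 0)
  set C' := 2 * δ + 4 * δ + 2 * dist (x 0) o + A with hC'
  have hd : 0 ≤ dist (x 0) o := dist_nonneg
  refine ⟨F, isQuasiAction_actionMap, isQuasiAction_translation hB.quasimorphism,
    ⟨1, 4 * (2 * δ) + 2 * δ, le_rfl, by positivity, fun s t => ?_, fun s t => ?_⟩,
    4 * C' + 2 * δ, by positivity, fun t g => ?_⟩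
  · have h := (hF s).abs_sub_le (hF t)
    rw [Real.dist_eq]
    linarith
  · have h := (hF s).dist_le hδ (hF t)
    rw [Real.dist_eq]
    linarith
  · have h := ((hF (t + B g)).mono (by linarith : 2 * δ ≤ C')).dist_le hδ
      ((hF t).smul hδ h0 (hx.seqRel hx) (hx.seqRel_smul hζ) (hy.seqRel_smul hξ) hA g)
    simpa [translation, actionMap] using h

end Boundary

end CoarseHyp

theorem mainTheorem6 {G : Type*} [Group G] {X : Type*} [MetricSpace X]
    [CoarseHyp.IsHyperbolicSpace X] [MulAction G X] [IsIsometricSMul G X]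
    (hG : CoarseHyp.IsTypeThreePlus G X)
    (ζ : CoarseHyp.Boundary X) (hζ : ζ ∈ CoarseHyp.limitSet G X) :
    (∃! B : G → ℝ, CoarseHyp.IsBusemannQuasimorphism ζ B) ∧
    (CoarseHyp.IsCobounded (CoarseHyp.actionMap G X) ↔ CoarseHyp.IsQuasiLine X) ∧
    ∀ B : G → ℝ, CoarseHyp.IsBusemannQuasimorphism ζ B →
      ∃ F : ℝ → X,
        CoarseHyp.IsReduction (CoarseHyp.actionMap G X) (CoarseHyp.translation B) F ∧
        (CoarseHyp.IsCobounded (CoarseHyp.actionMap G X) →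
          CoarseHyp.IsEquivalence (CoarseHyp.actionMap G X) (CoarseHyp.translation B) F) := by
  obtain ⟨ξ, hne, hfζ, hfξ⟩ : ∃ ξ : CoarseHyp.Boundary X,
      ζ ≠ ξ ∧ (∀ g : G, g • ζ = ζ) ∧ ∀ g : G, g • ξ = ξ := by
    obtain ⟨p, q, hpq, hlim, hfix⟩ := hG
    rw [hlim] at hζ
    rcases hζ with rfl | rfl
    · exact ⟨q, hpq, fun g => (hfix g).1, fun g => (hfix g).2⟩
    · exact ⟨p, hpq.symm, fun g => (hfix g).2, fun g => (hfix g).1⟩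
  have hB := CoarseHyp.existsUnique_isBusemannQuasimorphism hfζ
  refine ⟨hB, ?_, fun B hB => ?_⟩
  · obtain ⟨B, hB, -⟩ := hB
    obtain ⟨F, hF⟩ := hB.exists_isReduction hne hfζ hfξ
    obtain ⟨g, hg⟩ := hF.exists_ne_zero hζ
    obtain ⟨_, _, hh⟩ := hB
    exact ⟨fun hc => ⟨CoarseHyp.IsHyperbolicSpace.geodesic,
      (hF.isEquivalence hc).quasiIsometry.exists_inverse⟩, hF.isCobounded hh.homogeneous hg⟩
  · obtain ⟨F, hF⟩ := hB.exists_isReduction hne hfζ hfξ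
    exact ⟨F, hF, hF.isEquivalence⟩
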